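/- All graphs are simple and may be infinite. A graph is infinitely edge-connected if it has at least two vertices and remains connected after the deletion of any finite set of edges. A graph $H$ is a topological minor of a graph $G$ if some subgraph of $G$ is a subdivision of $H$. A graph is outerplanar if it has a (crossing-free) drawing in the plane in which every vertex lies on the unit circle and every edge is contained in the closed unit disc. A generalised halved Farey graph is a graph $\bigcup_{n\in\mathbb N} G_n$, where $G_0$ is a finite path with at least one edge all of whose edges are blue, and $G_{n+1}$ is obtained from $G_n$ by adding, for every blue edge $e=uv$ of $G_n$, a blue $u$--$v$ path $P_e$ of length at least two that is internally disjoint from $G_n$ and from every other added path $P_{e'}$, and then recolouring all edges of $G_n$ black (the edge colours are forgotten in the union). A set $\mathcal H$ of graphs is typical for a class $\mathcal G$ of graphs with regard to a relation $\le$ if $\mathcal H\subseteq\mathcal G$ and for every $G\in\mathcal G$ there is an $H\in\mathcal H$ with $H\le G$. Theorem. For every countable set of infinitely edge-connected graphs, there is a generalised halved Farey graph that is outerplanar and infinitely edge-connected and that contains none of them as a topological minor. Consequently, every set of graphs that is typical for the infinitely edge-connected graphs with regard to the topological minor relation is uncountable, and so is every set of graphs that is typical for the outerplanar infinitely edge-connected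 graphs with regard to the topological minor relation. -/

import Mathlib

universe u v

namespace SimpleGraph

/-- A graph is infinitely edge-connected if it has at least two vertices and is
`k`-edge-connected for every natural number `k`, that is, it stays connected whenever finitely
many edges are deleted. -/
def IsInfinitelyEdgeConnected {V : Type u} (G : SimpleGraph V) : Prop :=
  Nontrivial V ∧ ∀ k : ℕ, G.IsEdgeConnected k

/-- A subdivision of `H` inside `G`: the vertices of `H` are sent injectively to branch vertices
of `G`, and every edge of `H` is replaced by a path of `G` between the corresponding branch
vertices.  A path meets the set of branch vertices only in its two ends, and the paths of two
distinct edges meet only in branch vertices (hence only in common ends). -/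
structure SubdivisionIn {V : Type u} {W : Type v} (H : SimpleGraph V) (G : SimpleGraph W) where
  /-- the branch vertices -/
  branch : V → W
  branch_injective : Function.Injective branch
  /-- the path that replaces the edge `ab`, traversed from `a` to `b` -/
  path : ∀ a b : V, H.Adj a b → G.Walk (branch a) (branch b)
  path_isPath : ∀ (a b : V) (h : H.Adj a b), (path a b h).IsPath
  path_symm : ∀ (a b : V) (h : H.Adj a b), path b a h.symm = (path a b h).reverse
  branch_mem_path : ∀ (a b : V) (h : H.Adj a b) (c : V),
    branch c ∈ (path a b h).support → c = a ∨ c = b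
  path_disjoint : ∀ (a b : V) (h : H.Adj a b) (a' b' : V) (h' : H.Adj a' b'),
    s(a, b) ≠ s(a', b') → ∀ x : W, x ∈ (path a b h).support → x ∈ (path a' b' h').support →
      x ∈ Set.range branch

/-- `H` is a topological minor of `G`: some subgraph of `G` is a subdivision of `H`. -/
def IsTopologicalMinor {V : Type u} {W : Type v} (H : SimpleGraph V) (G : SimpleGraph W) : Prop :=
  Nonempty (SubdivisionIn H G)

/-- A drawing of `G` in the plane `ℂ` (without crossings): vertices are distinct points, every
edge is an arc (an injective path) between its ends, the interior of an arc contains no vertex,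
and the arcs of two distinct edges meet only in vertices. -/
structure PlaneDrawing {V : Type u} (G : SimpleGraph V) where
  /-- the position of a vertex -/
  point : V → ℂ
  point_injective : Function.Injective point
  /-- the arc that represents the edge `ab`, traversed from `a` to `b` -/
  arc : ∀ a b : V, G.Adj a b → _root_.Path (point a) (point b)
  arc_injective : ∀ (a b : V) (h : G.Adj a b), Function.Injective (arc a b h)
  arc_symm : ∀ (a b : V) (h : G.Adj a b), arc b a h.symm = (arc a b h).symm
  point_mem_arc : ∀ (a b : V) (h : G.Adj a b) (c : V),
    point c ∈ Set.range (arc a b h) → c = a ∨ c = b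
  arc_disjoint : ∀ (a b : V) (h : G.Adj a b) (a' b' : V) (h' : G.Adj a' b'),
    s(a, b) ≠ s(a', b') → ∀ x : ℂ, x ∈ Set.range (arc a b h) → x ∈ Set.range (arc a' b' h') →
      x ∈ Set.range point

/-- A graph is outerplanar if it has a drawing in which every vertex lies on the unit circle and
every edge is contained in the (closed) unit disc. -/
def IsOuterplanar {V : Type u} (G : SimpleGraph V) : Prop :=
  ∃ D : PlaneDrawing G, (∀ a : V, D.point a ∈ Metric.sphere (0 : ℂ) 1) ∧
    ∀ (a b : V) (h : G.Adj a b), Set.range (D.arc a b h) ⊆ Metric.closedBall (0 : ℂ) 1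

/-- `(H, B)`, a subgraph with its set of blue edges, is a non-trivial path all of whose edges are
blue. -/
def IsBluePath {V : Type u} {G : SimpleGraph V} (H : G.Subgraph) (B : Set (Sym2 V)) : Prop :=
  ∃ (a b : V) (p : G.Walk a b), p.IsPath ∧ 1 ≤ p.length ∧ H = p.toSubgraph ∧ B = H.edgeSet

/-- `(H', B')` is obtained from the edge-coloured graph `(H, B)` (with set of blue edges `B`) by
adding, for every blue edge `e = ab` of `H`, an `a`--`b` path `P e` of length at least two that is
internally disjoint from `H` and from all the other added paths; the edges of the added paths are
blue and all edges of `H` are recoloured black. -/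
def IsFareyStep {V : Type u} {G : SimpleGraph V} (H : G.Subgraph) (B : Set (Sym2 V))
    (H' : G.Subgraph) (B' : Set (Sym2 V)) : Prop :=
  ∃ P : Sym2 V → G.Subgraph,
    (∀ a b : V, s(a, b) ∈ B →
      ∃ p : G.Walk a b, p.IsPath ∧ 2 ≤ p.length ∧ P s(a, b) = p.toSubgraph) ∧
    (∀ e ∈ B, ∀ x ∈ (P e).verts, x ∈ H.verts → x ∈ e) ∧
    (∀ e ∈ B, ∀ e' ∈ B, e ≠ e' → ∀ x, x ∈ (P e).verts → x ∈ (P e').verts → x ∈ H.verts) ∧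
    H' = H ⊔ ⨆ e ∈ B, P e ∧
    B' = ⋃ e ∈ B, (P e).edgeSet

/-- `G` is a generalised halved Farey graph: it is the union of a sequence of edge-coloured
graphs `(H n, B n)` that starts with a blue non-trivial path and in which every later member
arises from the previous one by adding a path along every blue edge. -/
def IsGeneralisedHalvedFarey {V : Type u} (G : SimpleGraph V) : Prop :=
  ∃ (H : ℕ → G.Subgraph) (B : ℕ → Set (Sym2 V)),
    IsBluePath (H 0) (B 0) ∧
    (∀ n : ℕ, IsFareyStep (H n) (B n) (H (n + 1)) (B (n + 1))) ∧
    ⨆ n : ℕ, H n = ⊤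

end SimpleGraph

/-- A graph together with its vertex set. -/
abbrev AnyGraph : Type (u + 1) := Σ V : Type u, SimpleGraph V

namespace AnyGraph

/-- The topological minor relation between graphs. -/
def TopMinor (H G : AnyGraph.{u}) : Prop := H.2.IsTopologicalMinor G.2

/-- The class of infinitely edge-connected graphs. -/
def infinitelyEdgeConnected : Set AnyGraph.{u} := {G | G.2.IsInfinitelyEdgeConnected}

/-- The class of outerplanar graphs. -/
def outerplanar : Set AnyGraph.{u} := {G | G.2.IsOuterplanar}

/-- A set `S` of graphs is typical for a class `C` of graphs with regard to a relation `r` if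
`S ⊆ C` and every member of `C` is above some member of `S`. -/
def IsTypical (r : AnyGraph.{u} → AnyGraph.{u} → Prop) (C S : Set AnyGraph.{u}) : Prop :=
  S ⊆ C ∧ ∀ G ∈ C, ∃ H ∈ S, r H G

end AnyGraph

/-!
Fix a sequence `D 0 = 1`, `D 1`, `D 2`, ... in which every term properly divides the next. Take all
rationals `k / D n` in `[0, 1]` as vertices and join two of them if, for some `n`, they are
consecutive multiples of `1 / D n`. Passing from level `n` to level `n + 1` replaces every interval
of length `1 / D n` by a path of `D (n + 1) / D n ≥ 2` edges, so this is a generalised halved Farey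
graph (`FareyVertex.isGeneralisedHalvedFarey`). The level `n` edges form a path through all vertices
of level `n`, and these paths are edge-disjoint, which makes the graph infinitely edge-connected.
No two edges cross with respect to the order of the vertices, so the graph can be drawn with
vertices in this order on the circle and with straight edges (`FareyVertex.isOuterplanar`).

An edge that jumps over a vertex of level `n + 1` has level at most `n`, and there are at most
`(n + 1) * D n` such edges. Now let the graph contain a subdivision of an infinitely edge-connected
graph `H` with branch vertices `a < b`, and fix infinitely many edge-disjoint `a`--`b` walks in `H`.
Their images are edge-disjoint, hence all but finitely many of them visit any given vertex between
`a` and `b`; a subdividing vertex lies on at most one of them, so all vertices between `a` and `b`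
are branch vertices. For large `n`, one of the first `(n + 1) * D n + 1` images avoids all edges of
level at most `n`; it visits all vertices of level `n + 1` between `a` and `b`, so the walk of `H`
has at least `D (n + 1) / D n` vertices (`FareyVertex.exists_long_walk`). But the lengths of the
walks in `H` are fixed in advance, and a sequence `D` whose quotients grow faster than these lengths
can be chosen for countably many graphs `H` at the same time.
-/

/-! ### Farey graphs of a refining sequence -/

/-- A sequence of denominators: each one properly refines the previous one.  Level `n` of the
construction consists of the multiples of `1 / D n` in `[0, 1]`. -/
structure IsRefining (D : ℕ → ℕ) : Prop where
  zero : D 0 = 1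
  dvd_succ : ∀ n, D n ∣ D (n + 1)
  two_mul_le : ∀ n, 2 * D n ≤ D (n + 1)

namespace IsRefining

variable {D : ℕ → ℕ}


theorem pos (hD : IsRefining D) (n : ℕ) : 0 < D n := by
  induction n with
  | zero => simp [hD.zero]
  | succ n ih => have := hD.two_mul_le n; omega

theorem cast_pos (hD : IsRefining D) (n : ℕ) : (0 : ℚ) < D n := by exact_mod_cast hD.pos n

theorem strictMono (hD : IsRefining D) : StrictMono D :=
  strictMono_nat_of_lt_succ fun n => by have := hD.two_mul_le n; have := hD.pos n; omega

theorem dvd (hD : IsRefining D) {m n : ℕ} (h : m ≤ n) : D m ∣ D n := by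
  induction n, h using Nat.le_induction with
  | base => exact dvd_rfl
  | succ n _ ih => exact ih.trans (hD.dvd_succ n)

end IsRefining

/-- The vertices: all rationals `k / D n` with `k ≤ D n`.  The type lives in an arbitrary
universe. -/
@[ext]
structure FareyVertex (D : ℕ → ℕ) : Type u where
  /-- the position of the vertex in the unit interval -/
  val : ℚ
  exists_level : ∃ n k : ℕ, k ≤ D n ∧ val * D n = k

namespace FareyVertex

variable {D : ℕ → ℕ}

/-- The vertex `x` is a multiple of `1 / D n`. -/
def HasLevel (n : ℕ) (x : FareyVertex.{u} D) : Prop := ∃ k : ℕ, k ≤ D n ∧ x.val * D n = k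

/-- The vertices `x < y` are consecutive multiples of `1 / D n`. -/
def Step (n : ℕ) (x y : FareyVertex.{u} D) : Prop :=
  ∃ k : ℕ, k + 1 ≤ D n ∧ x.val * D n = k ∧ y.val * D n = k + 1

/-- The vertex `k / D n`, with `k` truncated at `D n`. -/
def point (D : ℕ → ℕ) (n k : ℕ) : FareyVertex.{u} D where
  val := (min k (D n) : ℕ) / D n
  exists_level := ⟨n, min k (D n), min_le_right _ _, by
    rcases Nat.eq_zero_or_pos (D n) with h | h
    · simp [h]
    · have : (D n : ℚ) ≠ 0 := by positivity
      field_simp⟩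

theorem point_val_mul (hD : IsRefining D) {n k : ℕ} (h : k ≤ D n) :
    (point.{u} D n k).val * D n = k := by
  have := (hD.cast_pos n).ne'
  simp only [point, min_eq_left h]
  field_simp

theorem eq_of_mul_eq (hD : IsRefining D) {n : ℕ} {x y : FareyVertex.{u} D}
    (h : x.val * D n = y.val * D n) : x = y :=
  FareyVertex.ext (mul_right_cancel₀ (hD.cast_pos n).ne' h)

theorem lt_of_mul_lt (hD : IsRefining D) {n : ℕ} {a b : ℚ} (h : a * D n < b * D n) : a < b :=
  lt_of_mul_lt_mul_right h (hD.cast_pos n).le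

theorem le_of_mul_le (hD : IsRefining D) {n : ℕ} {a b : ℚ} (h : a * D n ≤ b * D n) : a ≤ b :=
  le_of_mul_le_mul_right h (hD.cast_pos n)

theorem HasLevel.mono (hD : IsRefining D) {m n : ℕ} (h : m ≤ n) {x : FareyVertex.{u} D}
    (hx : x.HasLevel m) : x.HasLevel n := by
  obtain ⟨k, hk, hx⟩ := hx
  obtain ⟨c, hc⟩ := hD.dvd h
  refine ⟨k * c, hc ▸ Nat.mul_le_mul_right c hk, ?_⟩
  rw [hc]; push_cast; rw [← mul_assoc, hx]

theorem HasLevel.zero_le (hD : IsRefining D) {n : ℕ} {x : FareyVertex.{u} D}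
    (hx : x.HasLevel n) : 0 ≤ x.val := by
  obtain ⟨k, hk, hx⟩ := hx
  exact le_of_mul_le hD (n := n) (by rw [hx]; simp)

theorem HasLevel.le_one (hD : IsRefining D) {n : ℕ} {x : FareyVertex.{u} D}
    (hx : x.HasLevel n) : x.val ≤ 1 := by
  obtain ⟨k, hk, hx⟩ := hx
  exact le_of_mul_le hD (n := n) (by rw [hx]; simpa using hk)

namespace Step

variable {n : ℕ} {x y z : FareyVertex.{u} D}

theorem left (h : Step n x y) : x.HasLevel n := by
  obtain ⟨k, hk, hx, -⟩ := h
  exact ⟨k, by omega, hx⟩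

theorem right (h : Step n x y) : y.HasLevel n := by
  obtain ⟨k, hk, -, hy⟩ := h
  exact ⟨k + 1, hk, by simpa using hy⟩

theorem lt (hD : IsRefining D) (h : Step n x y) : x.val < y.val := by
  obtain ⟨k, hk, hx, hy⟩ := h
  exact lt_of_mul_lt hD (n := n) (by rw [hx, hy]; simp)

theorem sub_mul (h : Step n x y) : (y.val - x.val) * D n = 1 := by
  obtain ⟨k, hk, hx, hy⟩ := h
  linarith

/-- An edge determines its level. -/
theorem level_eq (hD : IsRefining D) {m : ℕ} (h : Step n x y) (h' : Step m x y) : n = m := by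
  have h1 := h.sub_mul
  have h2 := h'.sub_mul
  have h3 : y.val - x.val ≠ 0 := fun e => by simp [e] at h1
  exact hD.strictMono.injective (by exact_mod_cast mul_left_cancel₀ h3 (h1.trans h2.symm))

theorem not_between (hD : IsRefining D) (h : Step n x y) (hz : z.HasLevel n) :
    z.val ≤ x.val ∨ y.val ≤ z.val := by
  obtain ⟨k, hk, hx, hy⟩ := h
  obtain ⟨j, hj, hz⟩ := hz
  rcases Nat.lt_or_ge k j with hkj | hkj
  · right
    refine le_of_mul_le hD (n := n) ?_
    rw [hy, hz]; exact_mod_cast hkj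
  · left
    refine le_of_mul_le hD (n := n) ?_
    rw [hx, hz]; exact_mod_cast hkj

/-- An edge can jump over a vertex of level `m` only if the level of the edge is below `m`. -/
theorem lt_level (hD : IsRefining D) {m : ℕ} (h : Step n x y) (hz : z.HasLevel m)
    (hxz : x.val < z.val) (hzy : z.val < y.val) : n < m := by
  by_contra! hmn
  rcases h.not_between hD (hz.mono hD hmn) with h | h <;> linarith

end Step

/-- The Farey graph of the sequence `D`: on every level, consecutive vertices are joined. -/
def graph (D : ℕ → ℕ) : SimpleGraph (FareyVertex.{u} D) where
  Adj x y := ∃ n, Step n x y ∨ Step n y x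
  symm := ⟨fun _ _ ⟨n, h⟩ => ⟨n, h.symm⟩⟩
  loopless := ⟨by
    rintro x ⟨n, ⟨k, -, h1, h2⟩ | ⟨k, -, h1, h2⟩⟩ <;> simp [h1] at h2⟩

theorem Step.adj {n : ℕ} {x y : FareyVertex.{u} D} (h : Step n x y) : (graph D).Adj x y :=
  ⟨n, .inl h⟩

/-- The edges of level at most `n`. -/
def lowEdges (D : ℕ → ℕ) (n : ℕ) : Set (Sym2 (FareyVertex.{u} D)) :=
  {e | ∃ m ≤ n, ∃ x y, Step m x y ∧ e = s(x, y)}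

theorem exists_finset_lowEdges (hD : IsRefining D) (n : ℕ) :
    ∃ T : Finset (Sym2 (FareyVertex.{u} D)), T.card ≤ (n + 1) * D n ∧ lowEdges D n ⊆ T := by
  classical
  refine ⟨(Finset.range (n + 1) ×ˢ Finset.range (D n)).image
    fun p => s(point D p.1 p.2, point D p.1 (p.2 + 1)), ?_, ?_⟩
  · exact Finset.card_image_le.trans (by simp)
  · rintro e ⟨m, hm, x, y, ⟨k, hk, hx, hy⟩, rfl⟩
    have hmn := hD.strictMono.monotone hm
    simp only [Finset.coe_image, Set.mem_image, Finset.mem_coe, Finset.mem_product,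
      Finset.mem_range, Prod.exists]
    refine ⟨m, k, ⟨by omega, by omega⟩, ?_⟩
    rw [eq_of_mul_eq hD (x := point D m k) (hx ▸ point_val_mul hD (by omega)),
      eq_of_mul_eq hD (x := point D m (k + 1)) (y := y)
        (by rw [hy, point_val_mul hD hk]; push_cast; rfl)]

/-- A walk from the left of `z` to the right of `z` passes through `z` or uses an edge that
jumps over `z`; such an edge has a smaller level than `z`. -/
theorem mem_support_of_avoids (hD : IsRefining D) {n : ℕ} {a b z : FareyVertex.{u} D}
    (hz : z.HasLevel (n + 1)) (p : (graph D).Walk a b)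
    (hp : ∀ e ∈ p.edges, e ∉ lowEdges D n) (haz : a.val ≤ z.val) (hzb : z.val ≤ b.val) :
    z ∈ p.support := by
  induction p with
  | nil =>
    simpa using FareyVertex.ext (le_antisymm hzb haz)
  | @cons a c b h p ih =>
    rw [SimpleGraph.Walk.support_cons, List.mem_cons]
    rcases haz.eq_or_lt with haz | haz
    · exact .inl (FareyVertex.ext haz.symm)
    right
    refine ih (fun e he => hp e (by simp [he])) ?_ hzb
    by_contra! hzc
    have hac := hp s(a, c) (by simp)
    obtain ⟨m, hm | hm⟩ := h
    · exact hac
        ⟨m, Nat.lt_succ_iff.1 (hm.lt_level hD hz haz hzc), a, c, hm, rfl⟩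
    · linarith [hm.lt hD]

end FareyVertex

/-! ### The Farey graph is a generalised halved Farey graph and infinitely edge-connected -/

namespace FareyVertex

open SimpleGraph

variable {D : ℕ → ℕ}

/-- The path formed by the level `n` vertices in the interval `[s, t]`. -/
def levelPath (D : ℕ → ℕ) (n : ℕ) (s t : ℚ) : (graph.{u} D).Subgraph where
  verts := {z | z.HasLevel n ∧ s ≤ z.val ∧ z.val ≤ t}
  Adj x y := (Step n x y ∨ Step n y x) ∧
    (s ≤ x.val ∧ x.val ≤ t) ∧ (s ≤ y.val ∧ y.val ≤ t)
  adj_sub h := ⟨n, h.1⟩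
  edge_vert h := ⟨h.1.elim Step.left Step.right, h.2.1⟩
  symm := ⟨fun _ _ h => ⟨h.1.symm, h.2.2, h.2.1⟩⟩

theorem levelPath_self (hD : IsRefining D) {n : ℕ} {x : FareyVertex.{u} D} (hx : x.HasLevel n) :
    levelPath D n x.val x.val = (graph D).singletonSubgraph x := by
  ext a b
  · simp only [levelPath, Set.mem_ofPred_eq, singletonSubgraph_verts, Set.mem_singleton_iff]
    constructor
    · rintro ⟨-, h1, h2⟩
      exact FareyVertex.ext (le_antisymm h2 h1)
    · rintro rfl
      exact ⟨hx, le_rfl, le_rfl⟩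
  · refine ⟨?_, fun h => h.elim⟩
    rintro ⟨h | h, h1, h2⟩ <;> linarith [h.lt hD]

theorem levelPath_step (hD : IsRefining D) {n : ℕ} {x y : FareyVertex.{u} D} {t : ℚ}
    (hxy : Step n x y) (hyt : y.val ≤ t) :
    levelPath D n x.val t =
      (graph D).subgraphOfAdj hxy.adj ⊔ levelPath D n y.val t := by
  have hlt := hxy.lt hD
  ext a b
  · simp only [levelPath, Set.mem_ofPred_eq, Subgraph.verts_sup, subgraphOfAdj_verts, Set.mem_union,
      Set.mem_insert_iff, Set.mem_singleton_iff]
    constructor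
    · rintro ⟨h, h1, h2⟩
      rcases hxy.not_between hD h with h3 | h3
      · exact .inl (.inl (FareyVertex.ext (le_antisymm h3 h1)))
      · exact .inr ⟨h, h3, h2⟩
    · rintro ((rfl | rfl) | ⟨h, h1, h2⟩)
      · exact ⟨hxy.left, le_rfl, hlt.le.trans hyt⟩
      · exact ⟨hxy.right, hlt.le, hyt⟩
      · exact ⟨h, hlt.le.trans h1, h2⟩
  · have key : ∀ a b : FareyVertex.{u} D, Step n a b → x.val ≤ a.val → b.val ≤ t →
        (a = x ∧ b = y) ∨ y.val ≤ a.val := by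
      intro a b hab h1 h2
      rcases hxy.not_between hD hab.left with h3 | h3
      · left
        obtain rfl := FareyVertex.ext (le_antisymm h3 h1)
        have e1 := hab.sub_mul
        have e2 := hxy.sub_mul
        exact ⟨rfl, eq_of_mul_eq hD (n := n) (by linarith)⟩
      · exact .inr h3
    simp only [levelPath, Subgraph.sup_adj, subgraphOfAdj_adj, Sym2.eq_iff]
    constructor
    · rintro ⟨h | h, h1, h2⟩
      · rcases key a b h h1.1 h2.2 with ⟨rfl, rfl⟩ | h3
        · exact .inl (.inl ⟨rfl, rfl⟩)
        · exact .inr ⟨.inl h, ⟨h3, h1.2⟩, (h3.trans (h.lt hD).le), h2.2⟩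
      · rcases key b a h h2.1 h1.2 with ⟨rfl, rfl⟩ | h3
        · exact .inl (.inr ⟨rfl, rfl⟩)
        · exact .inr ⟨.inr h, ⟨h3.trans (h.lt hD).le, h1.2⟩, h3, h2.2⟩
    · rintro ((⟨rfl, rfl⟩ | ⟨rfl, rfl⟩) | ⟨h, h1, h2⟩)
      · exact ⟨.inl hxy, ⟨le_rfl, hlt.le.trans hyt⟩, hlt.le, hyt⟩
      · exact ⟨.inr hxy, ⟨hlt.le, hyt⟩, le_rfl, hlt.le.trans hyt⟩
      · exact ⟨h, ⟨hlt.le.trans h1.1, h1.2⟩, hlt.le.trans h2.1, h2.2⟩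

/-- Two level `n` vertices at distance `d / D n` are the ends of a path of length `d`, the one
that runs through the level `n` vertices between them. -/
theorem exists_walk_levelPath (hD : IsRefining D) {n : ℕ} (d : ℕ) :
    ∀ {i : ℕ} {x y : FareyVertex.{u} D}, i + d ≤ D n → x.val * D n = i → y.val * D n = i + d →
      ∃ p : (graph D).Walk x y, p.IsPath ∧ p.length = d ∧
        levelPath D n x.val y.val = p.toSubgraph := by
  induction d with
  | zero =>
    intro i x y hi hx hy
    obtain rfl := eq_of_mul_eq hD (hx.trans (by simpa using hy.symm))
    exact ⟨.nil, by simp, rfl, levelPath_self hD ⟨i, hi, hx⟩⟩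
  | succ d ih =>
    intro i x y hi hx hy
    have hz : (point.{u} D n (i + 1)).val * D n = (i + 1 : ℕ) := point_val_mul hD (by omega)
    obtain ⟨p, hp, hpl, hps⟩ := ih (i := i + 1) (x := point D n (i + 1)) (y := y) (by omega) hz
      (by rw [hy]; push_cast; ring)
    have hxz : Step n x (point D n (i + 1)) := ⟨i, by omega, hx, by rw [hz]; push_cast; rfl⟩
    have hzy : (point D n (i + 1)).val ≤ y.val := le_of_mul_le hD (n := n) (by
      rw [hz, hy]; push_cast; linarith [(Nat.cast_nonneg d : (0 : ℚ) ≤ d)])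
    refine ⟨.cons hxz.adj p, ?_, by simp [hpl], ?_⟩
    · rw [Walk.cons_isPath_iff]
      refine ⟨hp, fun hxp => ?_⟩
      rw [← Walk.mem_verts_toSubgraph, ← hps] at hxp
      linarith [hxp.2.1, hxz.lt hD]
    · rw [levelPath_step hD hxz hzy, hps]; rfl

/-- The finite stage `n` of the construction. -/
def stage (D : ℕ → ℕ) (n : ℕ) : (graph.{u} D).Subgraph where
  verts := {z | z.HasLevel n}
  Adj x y := (∃ m ≤ n, Step m x y ∨ Step m y x) ∧ x.HasLevel n ∧ y.HasLevel n
  adj_sub h := h.1.imp fun _ h => h.2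
  edge_vert h := h.2.1
  symm := ⟨fun _ _ h => ⟨h.1.imp fun _ h => ⟨h.1, h.2.symm⟩, h.2.2, h.2.1⟩⟩

/-- The edges of level `n`, which are the blue edges of the stage `n`. -/
def blueEdges (D : ℕ → ℕ) (n : ℕ) : Set (Sym2 (FareyVertex.{u} D)) :=
  {e | ∃ x y, Step n x y ∧ e = s(x, y)}

theorem mem_edgeSet_levelPath {n : ℕ} {s t : ℚ} {e : Sym2 (FareyVertex.{u} D)} :
    e ∈ (levelPath D n s t).edgeSet ↔
      ∃ x y, Step n x y ∧ e = s(x, y) ∧ (s ≤ x.val ∧ x.val ≤ t) ∧ (s ≤ y.val ∧ y.val ≤ t) := by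
  induction e with
  | _ a b =>
  rw [Subgraph.mem_edgeSet]
  constructor
  · rintro ⟨h | h, h1, h2⟩
    · exact ⟨a, b, h, rfl, h1, h2⟩
    · exact ⟨b, a, h, Sym2.eq_swap, h2, h1⟩
  · rintro ⟨x, y, h, e, h1, h2⟩
    rcases Sym2.eq_iff.1 e with ⟨rfl, rfl⟩ | ⟨rfl, rfl⟩
    · exact ⟨.inl h, h1, h2⟩
    · exact ⟨.inr h, h2, h1⟩

theorem isBluePath_stage_zero (hD : IsRefining D) :
    IsBluePath (stage.{u} D 0) (blueEdges D 0) := by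
  have h0 : (point.{u} D 0 0).val * D 0 = (0 : ℕ) := point_val_mul hD (Nat.zero_le _)
  have h1 : (point.{u} D 0 1).val * D 0 = (1 : ℕ) := point_val_mul hD hD.zero.ge
  obtain ⟨p, hp, hpl, hps⟩ := exists_walk_levelPath hD (n := 0) 1 (i := 0)
    (x := point D 0 0) (y := point D 0 1) (by simp [hD.zero]) h0 (by rw [h1]; simp)
  have e0 : (point.{u} D 0 0).val = 0 := by simpa [hD.zero] using h0
  have e1 : (point.{u} D 0 1).val = 1 := by simpa [hD.zero] using h1
  have hs : stage D 0 = levelPath D 0 (point.{u} D 0 0).val (point.{u} D 0 1).val := by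
    rw [e0, e1]
    have hz : ∀ z : FareyVertex.{u} D, z.HasLevel 0 → 0 ≤ z.val ∧ z.val ≤ 1 :=
      fun z h => ⟨h.zero_le hD, h.le_one hD⟩
    ext a b
    · exact ⟨fun h => ⟨h, hz _ h⟩, fun h => h.1⟩
    · constructor
      · rintro ⟨⟨m, hm, h⟩, ha, hb⟩
        obtain rfl := Nat.le_zero.1 hm
        exact ⟨h, hz _ ha, hz _ hb⟩
      · rintro ⟨h | h, -⟩
        · exact ⟨⟨0, le_rfl, .inl h⟩, h.left, h.right⟩
        · exact ⟨⟨0, le_rfl, .inr h⟩, h.right, h.left⟩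
  refine ⟨_, _, p, hp, hpl.ge, hs.trans hps, ?_⟩
  rw [hs, e0, e1]
  ext e
  rw [mem_edgeSet_levelPath]
  constructor
  · rintro ⟨x, y, h, rfl⟩
    exact ⟨x, y, h, rfl, ⟨h.left.zero_le hD, h.left.le_one hD⟩,
      h.right.zero_le hD, h.right.le_one hD⟩
  · rintro ⟨x, y, h, rfl, -⟩
    exact ⟨x, y, h, rfl⟩

/-- Every interval between consecutive vertices of level `n + 1` lies inside one of level `n`. -/
theorem exists_step_of_mul_eq (hD : IsRefining D) {n j : ℕ} (hj : j + 1 ≤ D (n + 1)) :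
    ∃ x y : FareyVertex.{u} D, Step n x y ∧ x.val * D (n + 1) ≤ j ∧
      (j + 1 : ℚ) ≤ y.val * D (n + 1) := by
  obtain ⟨c, hc⟩ := hD.dvd_succ n
  have hc0 : 0 < c := by
    rcases Nat.eq_zero_or_pos c with h | h
    · have := hD.pos (n + 1); simp [hc, h] at this
    · exact h
  have hk : j / c + 1 ≤ D n := by
    rw [Nat.succ_le_iff, Nat.div_lt_iff_lt_mul hc0, ← hc]; omega
  have h0 : (point.{u} D n (j / c)).val * D n = (j / c : ℕ) := point_val_mul hD (by omega)
  have h1 : (point.{u} D n (j / c + 1)).val * D n = (j / c + 1 : ℕ) := point_val_mul hD hk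
  refine ⟨point D n (j / c), point D n (j / c + 1), ⟨j / c, hk, h0, ?_⟩, ?_, ?_⟩
  · rw [h1]; push_cast; rfl
  · rw [hc, Nat.cast_mul, ← mul_assoc, h0]
    exact_mod_cast Nat.div_mul_le_self j c
  · rw [hc, Nat.cast_mul, ← mul_assoc, h1]
    exact_mod_cast Nat.lt_mul_of_div_lt (Nat.lt_succ_self (j / c)) hc0

theorem isFareyStep_stage (hD : IsRefining D) (n : ℕ) :
    IsFareyStep (stage.{u} D n) (blueEdges D n) (stage D (n + 1)) (blueEdges D (n + 1)) := by
  set P : Sym2 (FareyVertex.{u} D) → (graph.{u} D).Subgraph :=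
    fun e => levelPath D (n + 1) (e.map val).inf (e.map val).sup with hPdef
  have hP : ∀ {x y : FareyVertex.{u} D}, Step n x y →
      P s(x, y) = levelPath D (n + 1) x.val y.val := by
    intro x y h
    have := (h.lt hD).le
    simp [hPdef, Sym2.inf_mk, Sym2.sup_mk, this]
  have hwalk : ∀ {x y : FareyVertex.{u} D}, Step n x y → ∃ p : (graph D).Walk x y,
      p.IsPath ∧ 2 ≤ p.length ∧ P s(x, y) = p.toSubgraph := by
    intro x y h
    obtain ⟨k, hk, hx, hy⟩ := id h
    obtain ⟨c, hc⟩ := hD.dvd_succ n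
    have h2 : 2 ≤ c := by
      have := hD.two_mul_le n
      rw [hc, mul_comm 2] at this
      exact Nat.le_of_mul_le_mul_left this (hD.pos n)
    obtain ⟨p, hp, hpl, hps⟩ := exists_walk_levelPath hD (n := n + 1) c (i := k * c)
      (x := x) (y := y) (by rw [hc, ← Nat.succ_mul]; exact Nat.mul_le_mul_right c hk)
      (by rw [hc]; push_cast; rw [← mul_assoc, hx])
      (by rw [hc]; push_cast; rw [← mul_assoc, hy]; ring)
    exact ⟨p, hp, hpl ▸ h2, (hP h).trans hps⟩
  have hstage : stage D (n + 1) = stage.{u} D n ⊔ ⨆ e ∈ blueEdges D n, P e := by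
    ext a b
    · simp only [Subgraph.verts_sup, Subgraph.verts_iSup, Set.mem_union, Set.mem_iUnion]
      constructor
      · rintro ⟨j, hj, ha⟩
        rcases hj.eq_or_lt with rfl | hj
        · left
          refine HasLevel.mono hD (Nat.zero_le n) (x := a) ⟨1, hD.zero.ge, ?_⟩
          have h1 : a.val = 1 := by
            simpa [(hD.cast_pos (n + 1)).ne'] using ha
          simp [h1, hD.zero]
        · obtain ⟨x, y, h, hx, hy⟩ := exists_step_of_mul_eq.{u} hD hj
          refine .inr ⟨s(x, y), ⟨x, y, h, rfl⟩, ?_⟩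
          rw [hP h]
          exact ⟨⟨j, hj.le, ha⟩, le_of_mul_le hD (n := n + 1) (by rw [ha]; exact hx),
            le_of_mul_le hD (n := n + 1) (by rw [ha]; linarith)⟩
      · rintro (h | ⟨e, ⟨x, y, h, rfl⟩, ha⟩)
        · exact HasLevel.mono hD n.le_succ h
        · rw [hP h] at ha
          exact ha.1
    · simp only [Subgraph.sup_adj, Subgraph.iSup_adj]
      constructor
      · rintro ⟨⟨m, hm, hab⟩, ha, hb⟩
        rcases Nat.lt_or_ge n m with hnm | hnm
        · right
          obtain rfl : m = n + 1 := by omega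
          have key : ∀ {a b : FareyVertex.{u} D}, Step (n + 1) a b → ∃ x y : FareyVertex.{u} D, Step n x y ∧
              (levelPath.{u} D (n + 1) x.val y.val).Adj a b := by
            rintro a b ⟨j, hj, ha, hb⟩
            obtain ⟨x, y, h, hx, hy⟩ := exists_step_of_mul_eq.{u} hD hj
            have h1 : a.val ≤ y.val := le_of_mul_le hD (n := n + 1) (by rw [ha]; linarith)
            have h2 : x.val ≤ b.val := le_of_mul_le hD (n := n + 1) (by rw [hb]; linarith)
            exact ⟨x, y, h, .inl ⟨j, hj, ha, hb⟩,
              ⟨le_of_mul_le hD (n := n + 1) (by rw [ha]; exact hx), h1⟩,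
              h2, le_of_mul_le hD (n := n + 1) (by rw [hb]; exact hy)⟩
          rcases hab with hab | hab
          · obtain ⟨x, y, h, hxy⟩ := key hab
            exact ⟨s(x, y), ⟨x, y, h, rfl⟩, hP h ▸ hxy⟩
          · obtain ⟨x, y, h, hxy⟩ := key hab
            exact ⟨s(x, y), ⟨x, y, h, rfl⟩, hP h ▸ hxy.symm⟩
        · left
          rcases hab with hab | hab
          · exact ⟨⟨m, hnm, .inl hab⟩, hab.left.mono hD hnm, hab.right.mono hD hnm⟩
          · exact ⟨⟨m, hnm, .inr hab⟩, hab.right.mono hD hnm, hab.left.mono hD hnm⟩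
      · rintro (⟨⟨m, hm, hab⟩, ha, hb⟩ | ⟨e, ⟨x, y, h, rfl⟩, hab⟩)
        · exact ⟨⟨m, hm.trans n.le_succ, hab⟩, ha.mono hD n.le_succ, hb.mono hD n.le_succ⟩
        · rw [hP h] at hab
          exact ⟨⟨n + 1, le_rfl, hab.1⟩, hab.fst_mem.1, hab.snd_mem.1⟩
  refine ⟨P, ?_, ?_, ?_, hstage, ?_⟩
  · rintro a b ⟨x, y, h, e⟩
    obtain ⟨p, hp, hpl, hps⟩ := hwalk h
    rcases Sym2.eq_iff.1 e with ⟨rfl, rfl⟩ | ⟨rfl, rfl⟩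
    · exact ⟨p, hp, hpl, hps⟩
    · exact ⟨p.reverse, hp.reverse, by simpa using hpl, by rw [e, Walk.toSubgraph_reverse, hps]⟩
  · rintro e ⟨x, y, h, rfl⟩ z hz hzn
    rw [hP h] at hz
    rcases h.not_between hD hzn with h1 | h1
    · rw [FareyVertex.ext (le_antisymm h1 hz.2.1)]; simp
    · rw [FareyVertex.ext (le_antisymm hz.2.2 h1)]; simp
  · rintro e ⟨x, y, h, rfl⟩ e' ⟨x', y', h', rfl⟩ hne z hz hz'
    rw [hP h] at hz
    rw [hP h'] at hz'
    have hends : z = x ∨ z = y ∨ z = x' ∨ z = y' := by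
      by_contra! hcon
      obtain ⟨c1, c2, c3, c4⟩ := hcon
      have l1 := hz.2.1.lt_of_ne fun e => c1 (FareyVertex.ext e.symm)
      have l2 := hz.2.2.lt_of_ne fun e => c2 (FareyVertex.ext e)
      have l3 := hz'.2.1.lt_of_ne fun e => c3 (FareyVertex.ext e.symm)
      have l4 := hz'.2.2.lt_of_ne fun e => c4 (FareyVertex.ext e)
      -- two level `n` intervals with a common interior point coincide
      apply hne
      have hxx : x = x' := FareyVertex.ext (le_antisymm
        ((h'.not_between hD h.left).resolve_right (by linarith))
        ((h.not_between hD h'.left).resolve_right (by linarith)))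
      subst hxx
      have e1 := h.sub_mul
      have e2 := h'.sub_mul
      rw [eq_of_mul_eq hD (n := n) (x := y) (y := y') (by linarith)]
    rcases hends with rfl | rfl | rfl | rfl
    exacts [h.left, h.right, h'.left, h'.right]
  · ext e
    simp only [Set.mem_iUnion]
    constructor
    · rintro ⟨a, b, ⟨j, hj, ha, hb⟩, rfl⟩
      obtain ⟨x, y, h, hx, hy⟩ := exists_step_of_mul_eq.{u} hD hj
      refine ⟨s(x, y), ⟨x, y, h, rfl⟩, ?_⟩
      rw [hP h, mem_edgeSet_levelPath]
      exact ⟨a, b, ⟨j, hj, ha, hb⟩, rfl,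
        ⟨le_of_mul_le hD (n := n + 1) (by rw [ha]; exact hx),
          le_of_mul_le hD (n := n + 1) (by rw [ha]; linarith)⟩,
        le_of_mul_le hD (n := n + 1) (by rw [hb]; linarith),
        le_of_mul_le hD (n := n + 1) (by rw [hb]; exact hy)⟩
    · rintro ⟨e', ⟨x, y, h, rfl⟩, he⟩
      rw [hP h, mem_edgeSet_levelPath] at he
      obtain ⟨a, b, hab, rfl, -⟩ := he
      exact ⟨a, b, hab, rfl⟩

theorem isGeneralisedHalvedFarey (hD : IsRefining D) :
    (graph.{u} D).IsGeneralisedHalvedFarey := by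
  refine ⟨stage D, blueEdges D, isBluePath_stage_zero hD, isFareyStep_stage hD, ?_⟩
  ext a b
  · simp only [Subgraph.verts_iSup, Set.mem_iUnion, Subgraph.verts_top, Set.mem_univ, iff_true]
    exact a.exists_level
  · simp only [Subgraph.iSup_adj, Subgraph.top_adj]
    constructor
    · rintro ⟨n, ⟨m, -, h⟩, -⟩
      exact ⟨m, h⟩
    · rintro ⟨m, h | h⟩
      · exact ⟨m, ⟨m, le_rfl, .inl h⟩, h.left, h.right⟩
      · exact ⟨m, ⟨m, le_rfl, .inr h⟩, h.right, h.left⟩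

/-- If no edge of level `n` is deleted, the path of level `n` connects all vertices of that
level. -/
theorem reachable_of_level (hD : IsRefining D) {n : ℕ} {s : Set (Sym2 (FareyVertex.{u} D))}
    (hs : ∀ x y, Step n x y → s(x, y) ∉ s) {x : FareyVertex.{u} D} (hx : x.HasLevel n) :
    ((graph D).deleteEdges s).Reachable (point D n 0) x := by
  obtain ⟨k, hk, hx⟩ := hx
  induction k generalizing x with
  | zero =>
    rw [eq_of_mul_eq hD (n := n) (hx.trans (point_val_mul hD (Nat.zero_le _)).symm)]
  | succ k ih =>
    have hy : (point.{u} D n k).val * D n = k := point_val_mul hD (by omega)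
    have hstep : Step n (point D n k) x := ⟨k, hk, hy, by rw [hx]; push_cast; rfl⟩
    refine (ih (by omega) hy).trans (SimpleGraph.Adj.reachable ?_)
    rw [deleteEdges_adj]
    exact ⟨hstep.adj, hs _ _ hstep⟩

theorem isInfinitelyEdgeConnected (hD : IsRefining D) :
    (graph.{u} D).IsInfinitelyEdgeConnected := by
  have hne : point.{u} D 0 0 ≠ point D 0 1 := fun e => by
    have h0 := point_val_mul.{u} hD (n := 0) (k := 0) (Nat.zero_le _)
    have h1 := point_val_mul.{u} hD (n := 0) (k := 1) hD.zero.ge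
    rw [← e, h0] at h1
    simp at h1
  refine ⟨⟨_, _, hne⟩, fun k x y s hs => ?_⟩
  have hfin : s.Finite := Set.encard_lt_top_iff.1 (hs.trans (by simp))
  -- deleted edges meet only finitely many levels
  have hlev : {m | ∃ x y : FareyVertex.{u} D, Step m x y ∧ s(x, y) ∈ s}.Finite := by
    classical
    let lev : Sym2 (FareyVertex.{u} D) → ℕ :=
      fun e => if h : ∃ m x y, Step m x y ∧ e = s(x, y) then h.choose else 0
    refine (hfin.image lev).subset ?_
    rintro m ⟨x, y, h, hxy⟩
    refine ⟨s(x, y), hxy, ?_⟩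
    have hex : ∃ m a b, Step m a b ∧ s(x, y) = s(a, b) := ⟨m, x, y, h, rfl⟩
    obtain ⟨a, b, hab, e⟩ := hex.choose_spec
    have hl : lev s(x, y) = hex.choose := dif_pos hex
    rw [hl]
    rcases Sym2.eq_iff.1 e with ⟨rfl, rfl⟩ | ⟨rfl, rfl⟩
    · exact hab.level_eq hD h
    · linarith [hab.lt hD, h.lt hD]
  obtain ⟨i, hi⟩ := x.exists_level
  obtain ⟨j, hj⟩ := y.exists_level
  obtain ⟨N, hN⟩ := hlev.bddAbove
  have hs' : ∀ a b : FareyVertex.{u} D, Step (i + j + N + 1) a b → s(a, b) ∉ s := by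
    intro a b h hab
    have : i + j + N + 1 ≤ N := hN ⟨a, b, h, hab⟩
    omega
  exact (reachable_of_level hD hs' (HasLevel.mono hD (by omega) hi)).symm.trans
    (reachable_of_level hD hs' (HasLevel.mono hD (by omega) hj))

end FareyVertex

/-! ### Edge-disjoint walks and topological minors -/

namespace SimpleGraph

/-- In an infinitely edge-connected graph any two vertices are joined by an infinite sequence of
pairwise edge-disjoint walks, which can be chosen greedily. -/
theorem IsInfinitelyEdgeConnected.exists_disjoint_walks {V : Type u} {G : SimpleGraph V}
    (hG : G.IsInfinitelyEdgeConnected) (a b : V) :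
    ∃ w : ℕ → G.Walk a b, ∀ i j, i ≠ j → ∀ e ∈ (w i).edges, e ∉ (w j).edges := by
  classical
  have key : ∀ s : Finset (Sym2 V), ∃ p : G.Walk a b, ∀ e ∈ p.edges, e ∉ s := by
    intro s
    have h := hG.2 (s.card + 1) a b (s := (s : Set (Sym2 V)))
      (by rw [Set.encard_coe_eq_coe_finsetCard]; exact_mod_cast Nat.lt_succ_self _)
    obtain ⟨p⟩ := h
    refine ⟨p.mapLe (deleteEdges_le _), fun e he => ?_⟩
    rw [Walk.edges_mapLe_eq_edges] at he
    have := p.edges_subset_edgeSet he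
    rw [edgeSet_deleteEdges] at this
    exact fun h => this.2 h
  choose f hf using key
  -- `used n` collects the edges of the first `n` walks
  let used : ℕ → Finset (Sym2 V) := fun n => Nat.rec ∅ (fun _ s => s ∪ (f s).edges.toFinset) n
  have hmono : Monotone used := monotone_nat_of_le_succ fun n => Finset.subset_union_left
  have hlt : ∀ i j, i < j → ∀ e ∈ (f (used i)).edges, e ∉ (f (used j)).edges := by
    intro i j hij e he he'
    refine hf _ e he' (hmono (Nat.succ_le_of_lt hij) ?_)
    exact Finset.mem_union_right _ (List.mem_toFinset.2 he)
  refine ⟨fun n => f (used n), fun i j hij e he he' => ?_⟩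
  rcases Nat.lt_or_gt_of_ne hij with h | h
  · exact hlt i j h e he he'
  · exact hlt j i h e he' he

/-- Among more than `#T` pairwise disjoint lists there is one that avoids `T`. -/
theorem exists_list_avoids {α : Type*} (T : Finset α) (w : ℕ → List α)
    (hw : ∀ i j, i ≠ j → ∀ e ∈ w i, e ∉ w j) : ∃ i ≤ T.card, ∀ e ∈ w i, e ∉ T := by
  by_contra! h
  obtain ⟨x, -⟩ := h 0 (Nat.zero_le _)
  have : Nonempty α := ⟨x⟩
  choose! f hf hfT using h
  obtain ⟨i, hi, j, hj, hij, he⟩ := Finset.exists_ne_map_eq_of_card_lt_of_maps_to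
    (s := Finset.range (T.card + 1)) (t := T) (f := f) (by simp)
    (fun i hi => hfT i (by simpa [Nat.lt_succ_iff] using hi))
  simp only [Finset.mem_range, Nat.lt_succ_iff] at hi hj
  exact hw i j hij (f i) (hf i hi) (he ▸ hf j hj)

namespace SubdivisionIn

variable {V : Type u} {W : Type v} {H : SimpleGraph V} {G : SimpleGraph W}
  (S : SubdivisionIn H G)

/-- The walk in `G` that follows the subdivided edges of a walk in `H`. -/
def mapWalk : ∀ {a b : V}, H.Walk a b → G.Walk (S.branch a) (S.branch b)
  | _, _, .nil => .nil
  | _, _, .cons h p => (S.path _ _ h).append (mapWalk p)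

theorem exists_of_mem_edges_mapWalk {a b : V} (p : H.Walk a b) {e : Sym2 W}
    (he : e ∈ (S.mapWalk p).edges) :
    ∃ c d, ∃ h : H.Adj c d, s(c, d) ∈ p.edges ∧ e ∈ (S.path c d h).edges := by
  induction p with
  | nil => simp [mapWalk] at he
  | @cons a c b h p ih =>
    rw [mapWalk, Walk.edges_append, List.mem_append] at he
    rcases he with he | he
    · exact ⟨a, c, h, by simp, he⟩
    · obtain ⟨c, d, h, h1, h2⟩ := ih he
      exact ⟨c, d, h, by simp [h1], h2⟩

theorem exists_of_mem_support_mapWalk {a b : V} (p : H.Walk a b) {x : W}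
    (hx : x ∈ (S.mapWalk p).support) (hxb : x ∉ Set.range S.branch) :
    ∃ c d, ∃ h : H.Adj c d, s(c, d) ∈ p.edges ∧ x ∈ (S.path c d h).support := by
  induction p with
  | nil =>
    simp only [mapWalk, Walk.support_nil, List.mem_singleton] at hx
    exact (hxb ⟨_, hx.symm⟩).elim
  | @cons a c b h p ih =>
    rw [mapWalk, Walk.mem_support_append_iff] at hx
    rcases hx with hx | hx
    · exact ⟨a, c, h, by simp, hx⟩
    · obtain ⟨c, d, h, h1, h2⟩ := ih hx
      exact ⟨c, d, h, by simp [h1], h2⟩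

theorem mem_support_of_branch_mem {a b : V} (p : H.Walk a b) {c : V}
    (hc : S.branch c ∈ (S.mapWalk p).support) : c ∈ p.support := by
  induction p with
  | nil => simpa [mapWalk, S.branch_injective.eq_iff] using hc
  | @cons a d b h p ih =>
    rw [mapWalk, Walk.mem_support_append_iff] at hc
    rw [Walk.support_cons, List.mem_cons]
    rcases hc with hc | hc
    · rcases S.branch_mem_path a d h c hc with rfl | rfl
      · exact .inl rfl
      · exact .inr p.start_mem_support
    · exact .inr (ih hc)

theorem edge_eq_of_mem_path {a b a' b' : V} (h : H.Adj a b) (h' : H.Adj a' b') {e : Sym2 W}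
    (he : e ∈ (S.path a b h).edges) (he' : e ∈ (S.path a' b' h').edges) :
    s(a, b) = s(a', b') := by
  by_contra hne
  induction e with
  | _ x y =>
  have hxy : x ≠ y := (Walk.adj_of_mem_edges _ he).ne
  have hx := Walk.fst_mem_support_of_mem_edges _ he
  have hy := Walk.snd_mem_support_of_mem_edges _ he
  have hx' := Walk.fst_mem_support_of_mem_edges _ he'
  have hy' := Walk.snd_mem_support_of_mem_edges _ he'
  -- both ends of a common edge are branch vertices, so they are the ends of both paths
  obtain ⟨c, rfl⟩ := S.path_disjoint a b h a' b' h' hne x hx hx'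
  obtain ⟨d, rfl⟩ := S.path_disjoint a b h a' b' h' hne y hy hy'
  have hcd : c ≠ d := fun e => hxy (by rw [e])
  have h1 := S.branch_mem_path a b h c hx
  have h2 := S.branch_mem_path a b h d hy
  have h3 := S.branch_mem_path a' b' h' c hx'
  have h4 := S.branch_mem_path a' b' h' d hy'
  apply hne
  rw [Sym2.eq_iff]
  grind

theorem disjoint_edges_mapWalk {a b : V} {p q : H.Walk a b}
    (hpq : ∀ e ∈ p.edges, e ∉ q.edges) :
    ∀ e ∈ (S.mapWalk p).edges, e ∉ (S.mapWalk q).edges := by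
  intro e he he'
  obtain ⟨c, d, h, h1, h2⟩ := S.exists_of_mem_edges_mapWalk p he
  obtain ⟨c', d', h', h1', h2'⟩ := S.exists_of_mem_edges_mapWalk q he'
  exact hpq _ h1 (S.edge_eq_of_mem_path h h' h2 h2' ▸ h1')

/-- A vertex common to the images of two edge-disjoint walks is a branch vertex. -/
theorem mem_range_branch_of_mem_mapWalk {a b : V} {p q : H.Walk a b}
    (hpq : ∀ e ∈ p.edges, e ∉ q.edges) {x : W} (hp : x ∈ (S.mapWalk p).support)
    (hq : x ∈ (S.mapWalk q).support) : x ∈ Set.range S.branch := by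
  by_contra hx
  obtain ⟨c, d, h, h1, h2⟩ := S.exists_of_mem_support_mapWalk p hp hx
  obtain ⟨c', d', h', h1', h2'⟩ := S.exists_of_mem_support_mapWalk q hq hx
  exact hx (S.path_disjoint c d h c' d' h' (fun e => hpq _ h1 (e ▸ h1')) x h2 h2')

end SubdivisionIn

end SimpleGraph

/-! ### Outerplanarity -/

namespace FareyVertex

open SimpleGraph

variable {D : ℕ → ℕ}

/-- The rational parametrisation of the unit circle. -/
noncomputable def circlePoint (t : ℝ) : ℂ := ⟨(1 - t ^ 2) / (1 + t ^ 2), 2 * t / (1 + t ^ 2)⟩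

/-- An affine function that vanishes on the line through `circlePoint s` and `circlePoint t`. -/
def chordForm (s t : ℝ) (z : ℂ) : ℝ := (1 - s * t) * z.re + (s + t) * z.im - (1 + s * t)

theorem chordForm_circlePoint (s t r : ℝ) :
    chordForm s t (circlePoint r) = -(2 / (1 + r ^ 2)) * ((r - s) * (r - t)) := by
  have : 1 + r ^ 2 ≠ 0 := by positivity
  simp only [chordForm, circlePoint]
  field_simp
  ring

theorem norm_circlePoint (t : ℝ) : ‖circlePoint t‖ = 1 := by
  have : 1 + t ^ 2 ≠ 0 := by positivity
  rw [← sq_eq_sq₀ (norm_nonneg _) zero_le_one, Complex.sq_norm, Complex.normSq_apply]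
  simp only [circlePoint]
  field_simp
  ring

theorem eq_or_eq_of_chordForm {s t r : ℝ} (h : chordForm s t (circlePoint r) = 0) :
    r = s ∨ r = t := by
  rw [chordForm_circlePoint] at h
  have h1 : (-(2 / (1 + r ^ 2)) : ℝ) ≠ 0 := by
    have : (0 : ℝ) < 2 / (1 + r ^ 2) := by positivity
    exact neg_ne_zero.2 this.ne'
  rcases mul_eq_zero.1 ((mul_eq_zero.1 h).resolve_left h1) with h | h
  · exact .inl (sub_eq_zero.1 h)
  · exact .inr (sub_eq_zero.1 h)

theorem circlePoint_injective : Function.Injective circlePoint := by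
  intro s t h
  have := chordForm_circlePoint t t t
  rw [← h] at this
  simpa using eq_or_eq_of_chordForm (this.trans (by simp))

theorem chordForm_combo (s t : ℝ) (z w : ℂ) {α β : ℝ} (h : α + β = 1) :
    chordForm s t (α • z + β • w) = α * chordForm s t z + β * chordForm s t w := by
  simp only [chordForm, Complex.add_re, Complex.add_im, Complex.smul_re, Complex.smul_im,
    smul_eq_mul]
  linear_combination (1 + s * t) * h

theorem chordForm_eq_zero_of_mem_segment {s t : ℝ} {z : ℂ}
    (hz : z ∈ segment ℝ (circlePoint s) (circlePoint t)) : chordForm s t z = 0 := by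
  obtain ⟨α, β, -, -, h, rfl⟩ := hz
  rw [chordForm_combo s t _ _ h]
  simp [chordForm_circlePoint]

/-- Two chords of which neither separates the ends of the other can meet only in their ends. -/
theorem mem_segment_inter {s t s' t' : ℝ} {z : ℂ}
    (hnc : 0 ≤ ((s' - s) * (s' - t)) * ((t' - s) * (t' - t)))
    (hne : ¬ ((s' = s ∨ s' = t) ∧ (t' = s ∨ t' = t)))
    (hz : z ∈ segment ℝ (circlePoint s) (circlePoint t))
    (hz' : z ∈ segment ℝ (circlePoint s') (circlePoint t')) :
    z = circlePoint s' ∨ z = circlePoint t' := by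
  have h0 := chordForm_eq_zero_of_mem_segment hz
  obtain ⟨α, β, hα, hβ, h, rfl⟩ := hz'
  rw [chordForm_combo s t _ _ h] at h0
  rcases hα.eq_or_lt with rfl | hα
  · right; simp [show β = 1 by linarith]
  rcases hβ.eq_or_lt with rfl | hβ
  · left; simp [show α = 1 by linarith]
  exfalso
  have hp : 0 ≤ chordForm s t (circlePoint s') * chordForm s t (circlePoint t') := by
    rw [chordForm_circlePoint, chordForm_circlePoint]
    have : 0 ≤ (2 / (1 + s' ^ 2)) * (2 / (1 + t' ^ 2)) := by positivity
    calc 0 ≤ ((2 / (1 + s' ^ 2)) * (2 / (1 + t' ^ 2))) *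
          (((s' - s) * (s' - t)) * ((t' - s) * (t' - t))) := mul_nonneg this hnc
      _ = _ := by ring
  generalize hu : chordForm s t (circlePoint s') = u at *
  generalize hv : chordForm s t (circlePoint t') = v at *
  have hu0 : u = 0 := by
    have h1 : α * u ^ 2 + β * (u * v) = 0 := by linear_combination u * h0
    have h2 : 0 ≤ β * (u * v) := by positivity
    have h3 : 0 ≤ α * u ^ 2 := by positivity
    have h4 : α * u ^ 2 = 0 := by linarith
    simpa [hα.ne'] using h4
  have hv0 : v = 0 := by
    rw [hu0] at h0
    simpa [hβ.ne'] using h0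
  exact hne ⟨eq_or_eq_of_chordForm (hu.trans hu0), eq_or_eq_of_chordForm (hv.trans hv0)⟩

/-- The ends of an edge of the Farey graph do not separate the ends of another edge. -/
theorem mul_nonneg_of_adj (hD : IsRefining D) {a b c d : FareyVertex.{u} D}
    (hab : (graph D).Adj a b) (hcd : (graph D).Adj c d) :
    0 ≤ ((c.val - a.val) * (c.val - b.val)) * ((d.val - a.val) * (d.val - b.val)) := by
  have key : ∀ {a b c d : FareyVertex.{u} D} {m n : ℕ}, Step m a b → Step n c d →
      0 ≤ ((c.val - a.val) * (c.val - b.val)) * ((d.val - a.val) * (d.val - b.val)) := by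
    intro a b c d m n h h'
    have hlt := h.lt hD
    have hlt' := h'.lt hD
    rcases le_total m n with hmn | hmn
    · -- `a` and `b` have level `n`, so neither lies inside the interval from `c` to `d`
      rcases h'.not_between hD (h.left.mono hD hmn) with h1 | h1 <;>
      rcases h'.not_between hD (h.right.mono hD hmn) with h2 | h2
      · exact mul_nonneg (mul_nonneg (by linarith) (by linarith))
          (mul_nonneg (by linarith) (by linarith))
      · exact mul_nonneg_of_nonpos_of_nonpos
          (mul_nonpos_of_nonneg_of_nonpos (by linarith) (by linarith))
          (mul_nonpos_of_nonneg_of_nonpos (by linarith) (by linarith))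
      · linarith
      · exact mul_nonneg (mul_nonneg_of_nonpos_of_nonpos (by linarith) (by linarith))
          (mul_nonneg_of_nonpos_of_nonpos (by linarith) (by linarith))
    · rcases h.not_between hD (h'.left.mono hD hmn) with h1 | h1 <;>
      rcases h.not_between hD (h'.right.mono hD hmn) with h2 | h2
      all_goals
        refine mul_nonneg ?_ ?_
        all_goals
          first
          | exact mul_nonneg (by linarith) (by linarith)
          | exact mul_nonneg_of_nonpos_of_nonpos (by linarith) (by linarith)
  obtain ⟨m, hab | hab⟩ := hab <;> obtain ⟨n, hcd | hcd⟩ := hcd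
  · exact key hab hcd
  · linarith [key hab hcd]
  · linarith [key hab hcd]
  · linarith [key hab hcd]

/-- The Farey graph is drawn with its vertices on the unit circle, in the order given by their
values, and with straight edges. -/
theorem isOuterplanar (hD : IsRefining D) : (graph.{u} D).IsOuterplanar := by
  have hval : ∀ {x y : FareyVertex.{u} D}, ((x.val : ℚ) : ℝ) = y.val → x = y :=
    fun h => FareyVertex.ext (by exact_mod_cast h)
  have hinj : Function.Injective fun x : FareyVertex.{u} D => circlePoint x.val :=
    fun x y h => hval (circlePoint_injective h)
  refine ⟨{
    point := fun x => circlePoint x.val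
    point_injective := hinj
    arc := fun a b _ => Path.segment _ _
    arc_injective := fun a b h => Path.segment_injective_of_ne (hinj.ne h.ne)
    arc_symm := fun a b h => (Path.segment_symm _ _).symm
    point_mem_arc := ?_
    arc_disjoint := ?_ }, ?_, ?_⟩
  · intro a b h c hc
    rw [Path.range_segment] at hc
    exact (eq_or_eq_of_chordForm (chordForm_eq_zero_of_mem_segment hc)).imp hval hval
  · intro a b h a' b' h' hne x hx hx'
    rw [Path.range_segment] at hx hx'
    have hnc := mul_nonneg_of_adj hD h h'
    have hends : ¬ (((a'.val : ℝ) = a.val ∨ (a'.val : ℝ) = b.val) ∧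
        ((b'.val : ℝ) = a.val ∨ (b'.val : ℝ) = b.val)) := by
      rintro ⟨h1 | h1, h2 | h2⟩ <;> have e1 := hval h1 <;> have e2 := hval h2
      · exact h'.ne (e1.trans e2.symm)
      · exact hne (by rw [e1, e2])
      · exact hne (by rw [e1, e2, Sym2.eq_swap])
      · exact h'.ne (e1.trans e2.symm)
    rcases mem_segment_inter (by exact_mod_cast hnc) hends hx hx' with rfl | rfl
    · exact ⟨a', rfl⟩
    · exact ⟨b', rfl⟩
  · intro a
    simp [norm_circlePoint]
  · intro a b h
    rw [Path.range_segment]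
    exact (convex_closedBall (0 : ℂ) 1).segment_subset (by simp [norm_circlePoint])
      (by simp [norm_circlePoint])

end FareyVertex

/-! ### Excluding countably many topological minors -/

namespace FareyVertex

open SimpleGraph

variable {D : ℕ → ℕ}

/-- Suppose that the Farey graph contains a subdivision of `H`, and that `a` and `b` are joined in
`H` by edge-disjoint walks `w i`.  For large `n`, one of the first `(n + 1) * D n + 1` of these
walks has at least `D (n + 1) / D n` vertices. -/
theorem exists_long_walk (hD : IsRefining D) {V : Type v} {H : SimpleGraph V}
    (S : SubdivisionIn H (graph.{u} D)) {a b : V} (hab : (S.branch a).val < (S.branch b).val)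
    (w : ℕ → H.Walk a b) (hw : ∀ i j, i ≠ j → ∀ e ∈ (w i).edges, e ∉ (w j).edges) :
    ∃ N, ∀ n ≥ N, ∃ i ≤ (n + 1) * D n, D (n + 1) / D n ≤ (w i).length + 1 := by
  classical
  have havoid : ∀ M n : ℕ, ∃ i ≤ (n + 1) * D n,
      ∀ e ∈ (S.mapWalk (w (i + M))).edges, e ∉ lowEdges D n := by
    intro M n
    obtain ⟨T, hT, hsub⟩ := exists_finset_lowEdges.{u} hD n
    obtain ⟨i, hi, h⟩ := exists_list_avoids T (fun i => (S.mapWalk (w (i + M))).edges)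
      fun i j hij => S.disjoint_edges_mapWalk (hw _ _ (by omega))
    exact ⟨i, hi.trans hT, fun e he he' => h e he (hsub he')⟩
  -- every vertex between the two branch vertices lies on two of the walks, so it is a branch vertex
  have hbranch : ∀ z : FareyVertex.{u} D, (S.branch a).val ≤ z.val → z.val ≤ (S.branch b).val →
      z ∈ Set.range S.branch := by
    intro z h1 h2
    obtain ⟨n, hn⟩ := z.exists_level
    have hz : z.HasLevel (n + 1) := HasLevel.mono hD n.le_succ hn
    obtain ⟨i, -, hi⟩ := havoid 0 n
    obtain ⟨j, -, hj⟩ := havoid (i + 1) n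
    exact S.mem_range_branch_of_mem_mapWalk (hw (i + 0) (j + (i + 1)) (by omega))
      (mem_support_of_avoids hD hz _ hi h1 h2) (mem_support_of_avoids hD hz _ hj h1 h2)
  obtain ⟨m, hm⟩ := (S.branch a).exists_level
  obtain ⟨m', hm'⟩ := (S.branch b).exists_level
  refine ⟨m + m', fun n hn => ?_⟩
  obtain ⟨i, hi, hiw⟩ := havoid 0 n
  refine ⟨i, hi, ?_⟩
  obtain ⟨k, hk, ha⟩ := HasLevel.mono hD (show m ≤ n by omega) hm
  obtain ⟨l, hl, hb⟩ := HasLevel.mono hD (show m' ≤ n by omega) hm'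
  have hkl : k < l := by
    have := mul_lt_mul_of_pos_right hab (hD.cast_pos n)
    rw [ha, hb] at this
    exact_mod_cast this
  obtain ⟨c, hc⟩ := hD.dvd_succ n
  rw [hc, Nat.mul_div_cancel_left _ (hD.pos n)]
  -- the vertices `k / D n + t / D (n + 1)` with `t < c` are branch vertices on the walk `i`
  have hle : ∀ t < c, k * c + t ≤ l * c := fun t ht => by
    have : (k + 1) * c ≤ l * c := Nat.mul_le_mul_right c hkl
    linarith
  have hval : ∀ t < c, (point.{u} D (n + 1) (k * c + t)).val * D (n + 1) = (k * c + t : ℕ) :=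
    fun t ht => point_val_mul hD ((hle t ht).trans (hc ▸ Nat.mul_le_mul_right c hl))
  have hv : ∀ t < c, ∃ x ∈ (w i).support, S.branch x = point D (n + 1) (k * c + t) := by
    intro t ht
    have h1 : (S.branch a).val ≤ (point.{u} D (n + 1) (k * c + t)).val := by
      refine le_of_mul_le hD (n := n + 1) ?_
      rw [hval t ht, hc, Nat.cast_mul, ← mul_assoc, ha]
      exact_mod_cast Nat.le_add_right _ _
    have h2 : (point.{u} D (n + 1) (k * c + t)).val ≤ (S.branch b).val := by
      refine le_of_mul_le hD (n := n + 1) ?_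
      rw [hval t ht, hc, Nat.cast_mul, ← mul_assoc, hb]
      exact_mod_cast hle t ht
    obtain ⟨x, hx⟩ := hbranch _ h1 h2
    refine ⟨x, S.mem_support_of_branch_mem _ ?_, hx⟩
    rw [hx]
    exact mem_support_of_avoids hD ⟨k * c + t, (hle t ht).trans (hc ▸ Nat.mul_le_mul_right c hl),
      hval t ht⟩ _ hiw h1 h2
  have : Nonempty V := ⟨a⟩
  choose! f hf hfb using hv
  have hcard : (Finset.range c).card ≤ (w i).support.toFinset.card := by
    refine Finset.card_le_card_of_injOn f
      (fun t ht => List.mem_toFinset.2 (hf t (by simpa using ht))) ?_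
    intro t ht t' ht' e
    have ht1 : t < c := by simpa using ht
    have ht2 : t' < c := by simpa using ht'
    have h1 := hval t ht1
    rw [← hfb t ht1, e, hfb t' ht2, hval t' ht2] at h1
    have : k * c + t' = k * c + t := by exact_mod_cast h1
    omega
  rw [Finset.card_range] at hcard
  exact hcard.trans ((List.toFinset_card_le _).trans (by simp))

end FareyVertex

/-- A countable family of sequences of natural numbers is eventually dominated by one sequence. -/
theorem Set.Countable.exists_eventually_dominating {ι : Type*} {S : Set ι} (hS : S.Countable)
    (f : ι → ℕ → ℕ) : ∃ g : ℕ → ℕ, ∀ i ∈ S, ∃ N, ∀ n ≥ N, f i n ≤ g n := by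
  obtain ⟨c, hc⟩ := Set.countable_iff_exists_injOn.1 hS
  have hfin : ∀ n, (S ∩ c ⁻¹' Set.Iic n).Finite := fun n =>
    ((Set.finite_Iic n).subset (Set.image_subset_iff.2 fun _ h => h.2)).of_finite_image
      (hc.mono Set.inter_subset_left)
  refine ⟨fun n => ∑ i ∈ (hfin n).toFinset, f i n, fun i hi => ⟨c i, fun n hn => ?_⟩⟩
  exact Finset.single_le_sum (f := fun i => f i n) (fun _ _ => Nat.zero_le _)
    ((hfin n).mem_toFinset.2 ⟨hi, hn⟩)

/-- A refining sequence whose quotients `D (n + 1) / D n` are prescribed in terms of the number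
`(n + 1) * D n`, which bounds the number of edges of level at most `n`. -/
theorem exists_isRefining (g : ℕ → ℕ) :
    ∃ D, IsRefining D ∧ ∀ n, D (n + 1) / D n = g ((n + 1) * D n) + 2 := by
  let D : ℕ → ℕ := fun n => Nat.rec 1 (fun n d => d * (g ((n + 1) * d) + 2)) n
  have hsucc : ∀ n, D (n + 1) = D n * (g ((n + 1) * D n) + 2) := fun n => rfl
  have hD : IsRefining D := ⟨rfl, fun n => ⟨_, hsucc n⟩, fun n => by
    rw [hsucc, mul_comm]; exact Nat.mul_le_mul_left _ (by omega)⟩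
  exact ⟨D, hD, fun n => by rw [hsucc, Nat.mul_div_cancel_left _ (hD.pos n)]⟩

open SimpleGraph in
/-- For each excluded graph fix two vertices and infinitely many edge-disjoint walks between them.
The denominators are chosen so that their quotients outgrow the lengths of these walks. -/
theorem exists_farey_avoiding (S : Set AnyGraph.{u}) (hS : S.Countable)
    (hSc : S ⊆ AnyGraph.infinitelyEdgeConnected) :
    ∃ D, IsRefining D ∧ ∀ H ∈ S, ¬ H.2.IsTopologicalMinor (FareyVertex.graph.{u} D) := by
  classical
  have hwalks : ∀ H : AnyGraph.{u}, H ∈ S → ∃ a b : H.1, a ≠ b ∧ ∃ w : ℕ → H.2.Walk a b,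
      ∀ i j, i ≠ j → ∀ e ∈ (w i).edges, e ∉ (w j).edges := by
    intro H hH
    obtain ⟨a, b, hab⟩ := (hSc hH).1
    exact ⟨a, b, hab, (hSc hH).exists_disjoint_walks a b⟩
  choose a b hab w hw using hwalks
  -- `len H k` is the largest length among the first `k + 1` walks of `H`
  let len : AnyGraph.{u} → ℕ → ℕ := fun H k =>
    if h : H ∈ S then (Finset.range (k + 1)).sup fun i => (w H h i).length else 0
  obtain ⟨g, hg⟩ := hS.exists_eventually_dominating len
  obtain ⟨D, hD, hquot⟩ := exists_isRefining g
  refine ⟨D, hD, fun H hH ⟨T⟩ => ?_⟩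
  obtain ⟨N, hN⟩ := hg H hH
  have hlen : ∀ k, ∀ i ≤ k, (w H hH i).length ≤ len H k := by
    intro k i hi
    simp only [len, dif_pos hH]
    exact Finset.le_sup (f := fun i => (w H hH i).length) (by simpa [Nat.lt_succ_iff] using hi)
  have hlong : ∃ M, ∀ n ≥ M, ∃ i ≤ (n + 1) * D n, D (n + 1) / D n ≤ (w H hH i).length + 1 := by
    have hne : (T.branch (a H hH)).val ≠ (T.branch (b H hH)).val := fun e =>
      hab H hH (T.branch_injective (FareyVertex.ext e))
    rcases lt_or_gt_of_ne hne with hlt | hlt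
    · exact FareyVertex.exists_long_walk hD T hlt _ (hw H hH)
    · obtain ⟨M, hM⟩ := FareyVertex.exists_long_walk hD T hlt (fun i => (w H hH i).reverse)
        (by simpa using hw H hH)
      exact ⟨M, by simpa using hM⟩
  obtain ⟨M, hM⟩ := hlong
  obtain ⟨i, hi, hi'⟩ := hM (M + N) (Nat.le_add_right _ _)
  rw [hquot] at hi'
  have h1 := hlen _ i hi
  have h2 := hN ((M + N + 1) * D (M + N))
    (by have := Nat.le_mul_of_pos_right (M + N + 1) (hD.pos (M + N)); omega)
  omega

theorem theorem2 :
    (∀ S : Set AnyGraph.{u}, S.Countable → S ⊆ AnyGraph.infinitelyEdgeConnected →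
      ∃ (V : Type u) (G : SimpleGraph V),
        G.IsGeneralisedHalvedFarey ∧ G.IsOuterplanar ∧ G.IsInfinitelyEdgeConnected ∧
          ∀ H ∈ S, ¬ H.2.IsTopologicalMinor G) ∧
    (∀ S : Set AnyGraph.{u},
      AnyGraph.IsTypical AnyGraph.TopMinor AnyGraph.infinitelyEdgeConnected S →
        ¬ S.Countable) ∧
    (∀ S : Set AnyGraph.{u},
      AnyGraph.IsTypical AnyGraph.TopMinor
          (AnyGraph.outerplanar ∩ AnyGraph.infinitelyEdgeConnected) S →
        ¬ S.Countable) := by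
  refine ⟨fun S hS hSc => ?_, fun S hT hS => ?_, fun S hT hS => ?_⟩
  · obtain ⟨D, hD, h⟩ := exists_farey_avoiding S hS hSc
    exact ⟨_, _, FareyVertex.isGeneralisedHalvedFarey hD, FareyVertex.isOuterplanar hD,
      FareyVertex.isInfinitelyEdgeConnected hD, h⟩
  · obtain ⟨D, hD, h⟩ := exists_farey_avoiding S hS hT.1
    obtain ⟨H, hH, hle⟩ := hT.2 ⟨_, FareyVertex.graph D⟩ (FareyVertex.isInfinitelyEdgeConnected hD)
    exact h H hH hle
  · obtain ⟨D, hD, h⟩ := exists_farey_avoiding S hS (hT.1.trans Set.inter_subset_right)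
    obtain ⟨H, hH, hle⟩ := hT.2 ⟨_, FareyVertex.graph D⟩
      ⟨FareyVertex.isOuterplanar hD, FareyVertex.isInfinitelyEdgeConnected hD⟩
    exact h H hH hle
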